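/- For $n\in\mathbb N=\{0,1,2,\dots\}$ let $f(n)$ be the product of the decimal digits of $n$ (so $f(0)=0$), let $\Xi(n)$ be the least $k\ge 0$ such that $f^k(n)\le 9$ (such a $k$ always exists), and let $\Delta(n)=f^{\Xi(n)}(n)$ be the single digit that is reached. For a digit $d$ let $A_d=(V_d,E_d)$ be the smallest directed graph such that $d\in V_d$ and such that, whenever $s\in V_d$ and $x\in\mathbb N$ satisfy $f(f(x))=s$, we have $f(x)\in V_d$ and $(s,f(x))\in E_d$. For $a,b,c,e\ge 0$ let $D(a,b,c,e)$ be the set of integers in whose decimal expansion the digits $3,5,7,9$ occur exactly $a,b,c,e$ times respectively (at any positions) and all other digits, in any number, are equal to $1$. For $d\in\{1,3,7,9\}$ let $B_d=(U_d,F_d)$ with $U_d=\{d\}$ and $F_d=\{(d,d)\}$, and let $B_5=(U_5,F_5)$ with $$U_5=\{5,15,35,135,315,75,175,1715,1575,77175,3375,59535\},$$ $$F_5=\{(5,5),(5,15),(15,315),(15,135),(15,35),(315,3375),(3375,59535),(35,1715),(35,175),(35,75),(1715,77175),(175,1575)\}.$$ Then: 1. $A_d=B_d$ for every $d\in\{1,3,5,7,9\}$.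 2. For every $d\in\{1,3,5,7,9\}$, $$\{n:\Delta(n)=d\}=\bigcup_{\substack{\alpha,\beta,\gamma\ge 0\\ 3^\alpha5^\beta7^\gamma\in U_d}}\ \bigcup_{\substack{\alpha_1,\alpha_2\ge 0\\ \alpha_1+2\alpha_2=\alpha}}D(\alpha_1,\beta,\gamma,\alpha_2).$$ 3. If $\Delta(n)\in\{1,3,7,9\}$, then $\Xi(n)\le 1$, and if $\Delta(n)=5$, then $\Xi(n)\le 5$. Both bounds are optimal: for each $d\in\{1,3,7,9\}$ there is an $n$ with $\Delta(n)=d$ and $\Xi(n)=1$, and there is an $n$ with $\Delta(n)=5$ and $\Xi(n)=5$. 4. Consequently $\Xi(n)\le 5$ for every $n$ whose target $\Delta(n)$ is odd. -/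

import Mathlib

namespace MultPersistence

/-- The decimal digits of `n`, least significant first; the number `0` has the single digit `0`. -/
def decDigits (n : ℕ) : List ℕ := if n = 0 then [0] else Nat.digits 10 n

/-- `f n` is the product of the decimal digits of `n`. -/
def f (n : ℕ) : ℕ := (decDigits n).prod

theorem digits_prod_le (n : ℕ) : 0 < n → (Nat.digits 10 n).prod ≤ n := by
  induction n using Nat.strong_induction_on with
  | _ n ih =>
    intro hn
    rw [Nat.digits_def' (by norm_num) hn, List.prod_cons]
    rcases Nat.eq_zero_or_pos (n / 10) with h0 | h0
    · rw [h0]; simp; omega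
    · have h1 := ih (n / 10) (by omega) h0
      have h2 : n % 10 ≤ 9 := by omega
      have h3 := Nat.mul_le_mul h2 h1
      omega

/-- The digit product strictly decreases on numbers with at least two digits. -/
theorem f_lt_self {n : ℕ} (hn : 9 < n) : f n < n := by
  have h0 : n ≠ 0 := by omega
  have h1 := digits_prod_le (n / 10) (by omega)
  have h2 : n % 10 ≤ 9 := by omega
  have h3 := Nat.mul_le_mul h2 h1
  unfold f decDigits
  rw [if_neg h0, Nat.digits_def' (by norm_num) (by omega), List.prod_cons]
  omega

theorem exists_iterate_le_nine (n : ℕ) : ∃ k, f^[k] n ≤ 9 := by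
  induction n using Nat.strong_induction_on with
  | _ n ih =>
    by_cases h : n ≤ 9
    · exact ⟨0, h⟩
    · obtain ⟨k, hk⟩ := ih (f n) (f_lt_self (by omega))
      exact ⟨k + 1, hk⟩

/-- The height (multiplicative persistence) of `n`: the least `k` with `f^k(n) ≤ 9`. -/
def height (n : ℕ) : ℕ := Nat.find (exists_iterate_le_nine n)

/-- The target (multiplicative digital root) of `n`: the single digit that is reached. -/
def target (n : ℕ) : ℕ := f^[height n] n

/-- A directed graph with a set of natural numbers as its vertices. -/
@[ext]
structure NatGraph where
  verts : Set ℕ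
  edges : Set (ℕ × ℕ)

/-- The vertex set `V_d`: it contains `d`, and with `s` every `f x` for which `f (f x) = s`. -/
inductive IsAntecedent (d : ℕ) : ℕ → Prop
  | root : IsAntecedent d d
  | step (s x : ℕ) : IsAntecedent d s → f (f x) = s → IsAntecedent d (f x)

/-- The tree of antecedents `A_d = (V_d, E_d)` of `d`: its edges are the pairs `(s, f x)`
with `s ∈ V_d` and `f (f x) = s`. -/
def antecedentTree (d : ℕ) : NatGraph where
  verts := {s | IsAntecedent d s}
  edges := {e | IsAntecedent d e.1 ∧ ∃ x, f (f x) = e.1 ∧ f x = e.2}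

/-- The graph with the single vertex `d` and a loop at it. -/
def loopGraph (d : ℕ) : NatGraph where
  verts := {d}
  edges := {(d, d)}

/-- The explicit finite graph `B_5`. -/
def graphFive : NatGraph where
  verts := {5, 15, 35, 135, 315, 75, 175, 1715, 1575, 77175, 3375, 59535}
  edges := {(5, 5), (5, 15),
    (15, 315), (15, 135), (15, 35),
    (315, 3375), (3375, 59535),
    (35, 1715), (35, 175), (35, 75),
    (1715, 77175), (175, 1575)}

/-- The explicit graphs `B_d`, for the odd digits `d`. -/
def explicitGraph (d : ℕ) : NatGraph := if d = 5 then graphFive else loopGraph d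

/-- The integers in whose decimal expansion `3, 5, 7, 9` occur exactly `a, b, c, d` times, all the
other digits (in any number) being equal to `1`. -/
def digitClass (a b c d : ℕ) : Set ℕ :=
  {n | (decDigits n).count 3 = a ∧ (decDigits n).count 5 = b ∧ (decDigits n).count 7 = c ∧
    (decDigits n).count 9 = d ∧ ∀ x ∈ decDigits n, x ∈ ({1, 3, 5, 7, 9} : Set ℕ)}

end MultPersistence

open MultPersistence

/-!
Every number `f x` whose digit product is odd has odd digits only, and the digits of `x` are odd as
well, so that `f x = 3 ^ a * 5 ^ b * 7 ^ c`. The trees therefore result from the solutions of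
`f (3 ^ a * 5 ^ b * 7 ^ c) = s` with `s` in the tree, and the sets of numbers with a given target
are read off from the trees: `target n = d` holds if and only if `f n` is a vertex
(`target_eq_iff`).

If `b = 0`, then `3 ^ a * 7 ^ c` is congruent to `1`, `3`, `7` or `9` modulo `20`, so its tens digit
is even and the number has a single digit (`lt_ten_of_odd_f`). If `b > 0`, then the last digit is
`5`, so `5` divides `s`. This settles the digits `1`, `3`, `7`, `9`.

For the digit `5`, suppose that `m = 3 ^ a * 5 ^ b * 7 ^ c` with `b > 0` has only odd digits and
that its digit product is one of the twelve vertices `s`. The digits of `m` other than `1` are then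
known up to order, in one of finitely many ways (`digitTypes`), but the number of digits `1` is not
bounded. If `m` has more than six digits and `b ≥ 6`, then the number formed by its last six digits
is a multiple of `5 ^ 6`, which forces the product of these digits not to divide `s`
(`lt_six_of_f_mem`). For `1 ≤ b ≤ 5` a modular sieve applies.
With digits `2 * η i + 1`, the equation reads
`9 * (3 ^ a * (5 ^ b * 7 ^ c)) + 1 = 10 ^ n + 18 * ∑ i < n, η i * 10 ^ i`,
where only a bounded number of the `η i` are nonzero. Modulo a divisor of `10 ^ t - 1` both sides
depend only on `n` and the places of the nonzero `η i` modulo `t`, and on `a` and `c` modulo some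
`L`; modulo a power of ten they depend on the last digits. The sieve refines this information step
by step, by one more digit, by a multiple of `t` or by a multiple of `L`, and drops the cases in
which the two sides are not congruent. After the stages listed in `sieve` no case is left, for none
of the `digitTypes` (`excluded_of_mem`, a kernel computation), and `sieve_contradiction` concludes
that `m` has at most six digits. The remaining finite check is `edge_of_f_mem`.
-/

namespace MultPersistence

/-! ### The sieve -/

/-- `force n g` is `g n`. The recursor makes the kernel reduce `n` to a numeral before it
substitutes it into `g`, so that no computation is repeated. The functions of the sieve are written
with recursors, since they are meant to be evaluated by the kernel only. -/
noncomputable def force (n : ℕ) (g : ℕ → Bool) : Bool := Nat.rec (g 0) (fun i _ => g (Nat.succ i)) n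

/-- `choose x y z` is `y` if `x` holds and `z` otherwise. -/
noncomputable def choose (x y z : Bool) : Bool := Bool.rec z y x

/-- `anyBelow n g` tells whether `g i` holds for some `i < n`. -/
noncomputable def anyBelow (n : ℕ) (g : ℕ → Bool) : Bool :=
  Nat.rec false (fun i ih => choose (g i) true ih) n

/-- `anySub t N p acc g` tells whether `g (acc + p * X)` holds for some `X` of `t` decimal digits,
none of which exceeds the corresponding digit of `N`. -/
noncomputable def anySub (t : ℕ) : ℕ → ℕ → ℕ → (ℕ → Bool) → Bool :=
  Nat.rec (fun _ _ acc g => g acc)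
    (fun _ ih N p acc g => choose (Nat.beq N 0) (g acc)
      (force (Nat.div N 10) fun N' => force (Nat.mul 10 p) fun p' =>
        anyBelow (Nat.succ (Nat.mod N 10)) fun x =>
          force (Nat.add acc (Nat.mul x p)) fun acc' => ih N' p' acc' g)) t

/-- `anySpread t r N g` tells whether `g (X₀ + 10 ^ t * X₁ + ⋯ + 10 ^ (t * r) * Xᵣ)` holds for some
`X₀, …, Xᵣ` that add up to `N` digit by digit. -/
noncomputable def anySpread (t r : ℕ) : ℕ → (ℕ → Bool) → Bool :=
  Nat.rec (fun N g => g N)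
    (fun _ ih N g => choose (Nat.beq N 0) (g 0) <| anySub t N 1 0 fun X =>
      force (Nat.sub N X) fun N' =>
        ih N' fun Y => force (Nat.add X (Nat.mul (Nat.pow 10 t) Y)) g) r

/-- `powChain es q x` is `x ^ es.prod % q`, computed by successive powers modulo `q`. -/
noncomputable def powChain (es : List ℕ) (q : ℕ) : ℕ → ℕ :=
  List.rec (fun x => Nat.mod x q) (fun e _ ih x => ih (Nat.pow (Nat.mod x q) e)) es

/-- What a branch of the sieve knows about a solution of
`9 * (3 ^ a * (5 ^ b * 7 ^ c)) + 1 = 10 ^ n + 18 * ∑ i < n, η i * 10 ^ i`. The precise meaning of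
the fields is the predicate `Tracks`. -/
structure State where
  /-- The period: the places of the digits are known modulo `t`. -/
  t : ℕ
  /-- The exponents `a` and `c` are known modulo `L`. -/
  L : ℕ
  /-- The digits at the places below `j` are known. -/
  j : ℕ
  /-- The exponent of `5`. -/
  b : ℕ
  /-- The number of digits modulo `t`. -/
  k : ℕ
  /-- The sum of the `η i * 10 ^ i` for `i < j`. -/
  low : ℕ
  /-- The sum of the `10 ^ (i % t)` over the places `i ≥ j` with `η i = 1`. -/
  N₁ : ℕ
  /-- The sum of the `10 ^ (i % t)` over the places `i ≥ j` with `η i = 2`. -/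
  N₂ : ℕ
  /-- The sum of the `10 ^ (i % t)` over the places `i ≥ j` with `η i = 3`. -/
  N₃ : ℕ
  /-- The sum of the `10 ^ (i % t)` over the places `i ≥ j` with `η i = 4`. -/
  N₄ : ℕ
  /-- The representative of the exponent of `3` modulo `L`. -/
  a : ℕ
  /-- The representative of the exponent of `7` modulo `L`. -/
  c : ℕ
  /-- The number `9 * (3 ^ a * (5 ^ b * 7 ^ c))` for the representatives `a` and `c`. -/
  T : ℕ

/-- The ways of refining a state: by the next digit, or by an `r`-fold period or modulus of the
exponents. -/
inductive Refinement
  | digit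
  | period (r : ℕ)
  | exponents (r : ℕ)

/-- A stage of the sieve: a refinement, and the moduli for which the resulting states are tested. -/
structure Stage where
  refinement : Refinement
  /-- The last `j` digits are compared modulo the greatest common divisor of `wordMod * 5 ^ b` and
  `10 ^ j`; the value `0` stands for no comparison. -/
  wordMod : ℕ
  /-- A pair `(q, es)` stands for the comparison of the powers with exponent `es.prod` modulo `q`.
  Raising to this power makes the comparison depend on `a` and `c` modulo `L` only; its factors are
  listed separately to keep the intermediate powers small. -/
  tests : List (ℕ × List ℕ)

/-- The digit of value `d` at the place `j` is split off from `N`, the sum of the powers of ten that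
stand for the places of such digits: `anyDigit p N j low d g` tells whether the power of ten `p`
occurs in `N` and `g` holds for `N - p` and the extended known part `low + d * 10 ^ j`. -/
noncomputable def anyDigit (p N j low d : ℕ) (g : ℕ → ℕ → Bool) : Bool :=
  choose (Nat.beq (Nat.mod (Nat.div N p) 10) 0) false
    (force (Nat.sub N p) fun N' =>
      force (Nat.add low (Nat.mul d (Nat.pow 10 j))) fun low' => g N' low')

/-- `anyRefinement s g ref` tells whether `g` holds for some refinement of the state `s`. Since only
numbers with at least seven digits are excluded, nothing is known about the digits at the places
from `7` on, and there a refinement by a digit counts as successful. A vanishing exponent is known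
exactly and is not refined. -/
noncomputable def anyRefinement (s : State) (g : State → Bool) (ref : Refinement) : Bool :=
  State.rec (fun t L j b k low N₁ N₂ N₃ N₄ a c T => Refinement.rec
    (choose (Nat.ble 7 j) true
        (force (Nat.pow 10 (Nat.mod j t)) fun p => force (Nat.succ j) fun j' =>
          choose (g ⟨t, L, j', b, k, low, N₁, N₂, N₃, N₄, a, c, T⟩) true
          (choose (anyDigit p N₁ j low 1 fun N' low' =>
            g ⟨t, L, j', b, k, low', N', N₂, N₃, N₄, a, c, T⟩) true
          (choose (anyDigit p N₂ j low 2 fun N' low' =>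
            g ⟨t, L, j', b, k, low', N₁, N', N₃, N₄, a, c, T⟩) true
          (choose (anyDigit p N₃ j low 3 fun N' low' =>
            g ⟨t, L, j', b, k, low', N₁, N₂, N', N₄, a, c, T⟩) true
          (anyDigit p N₄ j low 4 fun N' low' =>
            g ⟨t, L, j', b, k, low', N₁, N₂, N₃, N', a, c, T⟩))))))
    (fun r => force (Nat.mul r t) fun t' =>
        anyBelow r fun i => force (Nat.add k (Nat.mul i t)) fun k' =>
        anySpread t (Nat.pred r) N₄ fun N₄' => anySpread t (Nat.pred r) N₂ fun N₂' =>
        anySpread t (Nat.pred r) N₃ fun N₃' => anySpread t (Nat.pred r) N₁ fun N₁' =>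
          g ⟨t', L, j, b, k', low, N₁', N₂', N₃', N₄', a, c, T⟩)
    (fun r => force (Nat.mul r L) fun L' =>
        anyBelow (Nat.rec 1 (fun _ _ => r) a) fun x => force (Nat.add a (Nat.mul x L)) fun a' =>
        anyBelow (Nat.rec 1 (fun _ _ => r) c) fun y => force (Nat.add c (Nat.mul y L)) fun c' =>
        force (Nat.mul 9 (Nat.mul (Nat.pow 3 a') (Nat.mul (Nat.pow 5 b) (Nat.pow 7 c')))) fun T' =>
          g ⟨t, L', j, b, k, low, N₁, N₂, N₃, N₄, a', c', T'⟩) ref) s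

/-- `congruent V T qs` tells whether `V` and `T` pass all the comparisons `qs`. -/
noncomputable def congruent (V T : ℕ) (qs : List (ℕ × List ℕ)) : Bool :=
  List.rec true (fun q _ ih => Prod.rec (fun q es =>
    choose (Nat.beq (powChain es q V) (powChain es q T)) ih false) q) qs

/-- `passes g s` tells whether the two sides of the equation agree in all the comparisons of the
stage `g`, as far as the state `s` determines them. -/
noncomputable def passes (g : Stage) (s : State) : Bool :=
  Stage.rec (fun _ m qs => State.rec (fun _ _ j b k low N₁ N₂ N₃ N₄ _ _ T =>
    choose
      (choose (Nat.beq m 0) true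
        (force (Nat.gcd (Nat.mul m (Nat.pow 5 b)) (Nat.pow 10 j)) fun w =>
          Nat.beq (Nat.mod (Nat.succ T) w) (Nat.mod (Nat.mul 18 low) w)))
      (force (Nat.add (Nat.pred (Nat.pow 10 k)) (Nat.mul 18 (Nat.add low
          (Nat.add N₁ (Nat.add (Nat.mul 2 N₂) (Nat.add (Nat.mul 3 N₃) (Nat.mul 4 N₄))))))) fun V =>
        congruent V T qs)
      false) s) g

/-- `survives gs s` tells whether some chain of refinements of `s` passes all the stages `gs`. -/
noncomputable def survives (gs : List Stage) : State → Bool :=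
  List.rec (fun _ => true) (fun g _ ih s => Stage.rec (fun ref m qs =>
    anyRefinement s (fun s' => choose (passes ⟨ref, m, qs⟩ s') (ih s') false) ref) g) gs

/-- The stages of the sieve. The periods are `1, 3, 6, 12, 24, 48`, and each modulus of a comparison
divides `10 ^ t - 1` for the period `t` reached. The choice keeps the number of surviving cases
small at every stage. -/
noncomputable def sieve : List Stage :=
  [⟨.digit, 2, []⟩, ⟨.digit, 2, []⟩, ⟨.digit, 2, []⟩, ⟨.digit, 2, []⟩,
   ⟨.exponents 2, 8, []⟩, ⟨.exponents 2, 80, []⟩,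
   ⟨.period 3, 0, [(27, []), (37, [9])]⟩,
   ⟨.period 2, 0, [(7, [3]), (11, [5]), (13, [3]), (37, [9])]⟩,
   ⟨.exponents 3, 80, [(7, []), (13, []), (37, [3])]⟩,
   ⟨.exponents 5, 400, [(11, [])]⟩,
   ⟨.period 2, 0, [(101, [5]), (9901, [165])]⟩,
   ⟨.period 2, 0, [(73, [6]), (137, [34]), (99990001, [132, 125, 101])]⟩,
   ⟨.exponents 2, 800, [(73, [3]), (137, [17])]⟩,
   ⟨.exponents 3, 800, [(73, []), (9901, [55]), (99990001, [22, 125, 101])]⟩,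
   ⟨.digit, 800, []⟩, ⟨.digit, 800, []⟩,
   ⟨.exponents 2, 1600, [(99990001, [11, 125, 101])]⟩,
   ⟨.exponents 5, 8000, [(101, []), (9901, [11]), (99990001, [275, 101])]⟩,
   ⟨.period 2, 0, [(17, [])]⟩,
   ⟨.digit, 8000, []⟩, ⟨.exponents 2, 16000, []⟩, ⟨.exponents 5, 80000, [(99990001, [55, 101])]⟩]

/-- The sieve leaves no case with `1 ≤ b ≤ 5` and with `n₁, n₂, n₃, n₄` digits `3, 5, 7, 9`. The
initial states have period `1`, and distinguish only whether `a` and `c` vanish. -/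
noncomputable def excluded (n₁ n₂ n₃ n₄ : ℕ) : Bool :=
  not (anyBelow 5 fun i => anyBelow 2 fun a => anyBelow 2 fun c =>
    survives sieve ⟨1, 1, 0, i + 1, 0, 0, n₁, n₂, n₃, n₄, a, c,
      9 * (3 ^ a * (5 ^ (i + 1) * 7 ^ c))⟩)

/-! ### Correctness of the search functions -/

theorem force_eq (n : ℕ) (g : ℕ → Bool) : force n g = g n := by cases n <;> rfl

theorem choose_eq (x y z : Bool) : choose x y z = bif x then y else z := by cases x <;> rfl

theorem anyBelow_of_lt {n i : ℕ} {g : ℕ → Bool} (hi : i < n) (hg : g i = true) :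
    anyBelow n g = true := by
  induction n with
  | zero => omega
  | succ n ih =>
    change choose (g n) true (anyBelow n g) = true
    rw [choose_eq]
    rcases Nat.lt_succ_iff_lt_or_eq.mp hi with h | rfl
    · simp [ih h]
    · simp [hg]

theorem powChain_eq (es : List ℕ) (q x : ℕ) : powChain es q x = x ^ es.prod % q := by
  induction es generalizing x with
  | nil => simp only [List.prod_nil, pow_one]; rfl
  | cons e es ih =>
    change powChain es q ((x % q) ^ e) = _
    rw [ih, List.prod_cons, pow_mul, Nat.pow_mod, Nat.pow_mod (x % q), Nat.mod_mod,
      ← Nat.pow_mod x, ← Nat.pow_mod]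

/-- The sum of the powers of ten with exponents `e i`, for `i ∈ S`. If `S` has at most nine
elements, the decimal digits of this number count how often each exponent occurs. -/
def powSum (S : Finset ℕ) (e : ℕ → ℕ) : ℕ := ∑ i ∈ S, 10 ^ e i

theorem powSum_eq_zero {S : Finset ℕ} {e : ℕ → ℕ} (h : powSum S e = 0) : S = ∅ := by
  rw [powSum, Finset.sum_eq_zero_iff] at h
  rw [Finset.eq_empty_iff_forall_notMem]
  intro i hi
  have := h i hi
  simp at this

theorem powSum_filter_add (S : Finset ℕ) (e : ℕ → ℕ) (P : ℕ → Prop) [DecidablePred P] :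
    powSum (S.filter P) e + powSum (S.filter fun i => ¬ P i) e = powSum S e :=
  Finset.sum_filter_add_sum_filter_not S P _

theorem powSum_congr {S : Finset ℕ} {e e' : ℕ → ℕ} (h : ∀ i ∈ S, e i = e' i) :
    powSum S e = powSum S e' :=
  Finset.sum_congr rfl fun i hi => by rw [h i hi]

theorem powSum_add_const (S : Finset ℕ) (e : ℕ → ℕ) (t : ℕ) :
    powSum S (fun i => t + e i) = 10 ^ t * powSum S e := by
  simp [powSum, Finset.mul_sum, pow_add]

theorem powSum_eq_card_add (S : Finset ℕ) (e : ℕ → ℕ) :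
    powSum S e = (S.filter (e · = 0)).card +
      10 * powSum (S.filter fun i => ¬ e i = 0) (fun i => e i - 1) := by
  rw [← powSum_filter_add S e (e · = 0)]
  congr 1
  · rw [powSum, Finset.card_eq_sum_ones]
    refine Finset.sum_congr rfl fun i hi => ?_
    rw [(Finset.mem_filter.mp hi).2, pow_zero]
  · have h := powSum_add_const (S.filter fun i => ¬ e i = 0) (fun i => e i - 1) 1
    rw [pow_one] at h
    rw [← h]
    refine powSum_congr fun i hi => ?_
    have := (Finset.mem_filter.mp hi).2
    omega

/-- The search for a sub-multiset of the places is complete. At most nine powers of ten are added,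
so there are no carries, and the decimal digits of `powSum S e` are multiplicities. -/
theorem anySub_of_subset {t : ℕ} {S S' : Finset ℕ} {e : ℕ → ℕ} {p acc : ℕ} {g : ℕ → Bool}
    (hS' : S' ⊆ S) (hS : S.card ≤ 9) (he : ∀ i ∈ S, e i < t)
    (hg : g (acc + powSum S' e * p) = true) : anySub t (powSum S e) p acc g = true := by
  induction t generalizing S S' e p acc with
  | zero =>
    have h : S' = ∅ := Finset.eq_empty_iff_forall_notMem.mpr fun i hi => by
      simpa using he i (hS' hi)
    rw [h] at hg
    change g acc = true
    simpa [powSum] using hg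
  | succ t ih =>
    change choose (Nat.beq (powSum S e) 0) (g acc) (force (Nat.div (powSum S e) 10) fun N' =>
      force (Nat.mul 10 p) fun p' => anyBelow (Nat.succ (Nat.mod (powSum S e) 10)) fun x =>
        force (Nat.add acc (Nat.mul x p)) fun acc' => anySub t N' p' acc' g) = true
    rw [choose_eq]
    by_cases h0 : powSum S e = 0
    · have h : S' = ∅ := Finset.subset_empty.mp (powSum_eq_zero h0 ▸ hS')
      rw [h0]
      simpa [h, powSum] using hg
    · rw [show Nat.beq (powSum S e) 0 = false by
        rw [← Bool.not_eq_true]; exact fun h => h0 (Nat.eq_of_beq_eq_true h)]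
      simp only [cond_false, force_eq]
      have hc : (S.filter (e · = 0)).card ≤ 9 := (Finset.card_filter_le _ _).trans hS
      have hdec := powSum_eq_card_add S e
      have hmod : Nat.mod (powSum S e) 10 = (S.filter (e · = 0)).card := by
        change powSum S e % 10 = _
        omega
      have hdiv : Nat.div (powSum S e) 10 =
          powSum (S.filter fun i => ¬ e i = 0) (fun i => e i - 1) := by
        change powSum S e / 10 = _
        omega
      refine anyBelow_of_lt (i := (S'.filter (e · = 0)).card) ?_ ?_
      · rw [hmod]
        exact Nat.lt_succ_of_le (Finset.card_le_card (Finset.filter_subset_filter _ hS'))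
      · rw [hdiv]
        refine ih (Finset.filter_subset_filter _ hS') ((Finset.card_filter_le _ _).trans hS)
          (fun i hi => ?_) ?_
        · have h1 := Finset.mem_filter.mp hi
          have := he i h1.1
          omega
        · rw [powSum_eq_card_add S' e] at hg
          convert hg using 2
          change acc + _ * p + _ * (10 * p) = _
          ring

/-- If the exponents `e i` are known modulo `t` and are less than `(r + 1) * t`, then the search
over all distributions of the terms among the `r + 1` residue intervals finds the true one. -/
theorem anySpread_of_powSum {t r : ℕ} {S : Finset ℕ} {e : ℕ → ℕ} {g : ℕ → Bool} (ht : 0 < t)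
    (hS : S.card ≤ 9) (he : ∀ i ∈ S, e i < (r + 1) * t) (hg : g (powSum S e) = true) :
    anySpread t r (powSum S fun i => e i % t) g = true := by
  induction r generalizing S e g with
  | zero =>
    change g _ = true
    rwa [powSum_congr fun i hi => Nat.mod_eq_of_lt (by simpa using he i hi)]
  | succ r ih =>
    change choose (Nat.beq (powSum S fun i => e i % t) 0) (g 0)
      (anySub t (powSum S fun i => e i % t) 1 0 fun X =>
        force (Nat.sub (powSum S fun i => e i % t) X) fun N' => anySpread t r N' fun Y =>
          force (Nat.add X (Nat.mul (Nat.pow 10 t) Y)) g) = true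
    rw [choose_eq]
    by_cases h0 : powSum S (fun i => e i % t) = 0
    · rw [h0]
      simpa [powSum_eq_zero h0, powSum] using hg
    · rw [show Nat.beq (powSum S fun i => e i % t) 0 = false by
        rw [← Bool.not_eq_true]; exact fun h => h0 (Nat.eq_of_beq_eq_true h)]
      simp only [cond_false, force_eq]
      refine anySub_of_subset (S' := S.filter (e · < t)) (Finset.filter_subset _ _) hS
        (fun i _ => Nat.mod_lt _ ht) ?_
      have hX : powSum (S.filter (e · < t)) (fun i => e i % t) = powSum (S.filter (e · < t)) e :=
        powSum_congr fun i hi => Nat.mod_eq_of_lt (Finset.mem_filter.mp hi).2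
      have hN : Nat.sub (powSum S fun i => e i % t)
          (0 + powSum (S.filter (e · < t)) (fun i => e i % t) * 1) =
          powSum (S.filter fun i => ¬ e i < t) (fun i => (e i - t) % t) := by
        rw [zero_add, mul_one, ← powSum_filter_add S (fun i => e i % t) (e · < t)]
        refine (Nat.add_sub_cancel_left _ _).trans (powSum_congr fun i hi => ?_)
        have := (Finset.mem_filter.mp hi).2
        exact Nat.mod_eq_sub_mod (by omega)
      rw [hN]
      refine ih ((Finset.card_filter_le _ _).trans hS) (fun i hi => ?_) ?_
      · have h1 := Finset.mem_filter.mp hi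
        have h2 := he i h1.1
        have h3 : (r + 1 + 1) * t = (r + 1) * t + t := by ring
        omega
      · convert hg using 2
        change 0 + _ * 1 + 10 ^ t * _ = _
        rw [zero_add, mul_one, hX, ← powSum_add_const, ← powSum_filter_add S e (e · < t)]
        congr 1
        refine powSum_congr fun i hi => ?_
        have := (Finset.mem_filter.mp hi).2
        omega

/-! ### States and their refinements -/

theorem choose_true_right (x z : Bool) : choose x true z = (x || z) := by cases x <;> rfl

theorem choose_false_right (x y : Bool) : choose x y false = (x && y) := by cases x <;> rfl

theorem powSum_div_mod {S : Finset ℕ} {e : ℕ → ℕ} (hS : S.card ≤ 9) (r : ℕ) :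
    powSum S e / 10 ^ r % 10 = (S.filter (e · = r)).card := by
  induction r generalizing S e with
  | zero =>
    have := powSum_eq_card_add S e
    have : (S.filter (e · = 0)).card ≤ 9 := (Finset.card_filter_le _ _).trans hS
    simp only [pow_zero, Nat.div_one]
    omega
  | succ r ih =>
    have h1 := powSum_eq_card_add S e
    have h2 : (S.filter (e · = 0)).card ≤ 9 := (Finset.card_filter_le _ _).trans hS
    rw [pow_succ', ← Nat.div_div_eq_div_mul, show powSum S e / 10 =
      powSum (S.filter fun i => ¬ e i = 0) (fun i => e i - 1) by omega,
      ih ((Finset.card_filter_le _ _).trans hS), Finset.filter_filter]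
    congr 1
    ext i
    simp only [Finset.mem_filter]
    constructor
    · rintro ⟨hi, h3, h4⟩
      exact ⟨hi, by omega⟩
    · rintro ⟨hi, h3⟩
      exact ⟨hi, by omega, by omega⟩

/-- The places `j ≤ i < n` at which the digit sequence `η` takes the value `δ`. -/
def places (η : ℕ → ℕ) (n j δ : ℕ) : Finset ℕ := (Finset.Ico j n).filter (η · = δ)

theorem places_of_eq {η : ℕ → ℕ} {n j δ : ℕ} (hj : j < n) (h : η j = δ) :
    j ∈ places η n j δ := by
  simp [places, hj, h]

theorem powSum_places_of_eq {η : ℕ → ℕ} {n j δ : ℕ} (e : ℕ → ℕ) (hj : j < n) (h : η j = δ) :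
    powSum (places η n j δ) e = 10 ^ e j + powSum (places η n (j + 1) δ) e := by
  rw [places, ← Finset.insert_Ico_add_one_left_eq_Ico hj, Finset.filter_insert, if_pos h, powSum,
    Finset.sum_insert (by simp)]
  rfl

theorem places_of_ne {η : ℕ → ℕ} {n j δ : ℕ} (hj : j < n) (h : η j ≠ δ) :
    places η n (j + 1) δ = places η n j δ := by
  rw [places, places, ← Finset.insert_Ico_add_one_left_eq_Ico hj, Finset.filter_insert, if_neg h]

theorem card_places_le (η : ℕ → ℕ) (n j δ : ℕ) :
    (places η n j δ).card ≤ (places η n 0 δ).card :=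
  Finset.card_le_card (Finset.filter_subset_filter _ (Finset.Ico_subset_Ico_left (Nat.zero_le _)))

/-- `a'` represents the exponent `a` modulo `L`; the exponent `0` is represented by itself only. -/
def Represents (L a a' : ℕ) : Prop := (a = 0 ∧ a' = 0) ∨ (0 < a' ∧ ∃ q, a = a' + L * q)

theorem Represents.exists_refinement {L a a' r : ℕ} (h : Represents L a a') (hr : 0 < r) :
    ∃ x < (Nat.rec 1 (fun _ _ => r) a' : ℕ), Represents (r * L) a (a' + x * L) := by
  rcases h with ⟨rfl, rfl⟩ | ⟨h0, q, rfl⟩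
  · exact ⟨0, Nat.one_pos, Or.inl ⟨rfl, by simp⟩⟩
  · obtain ⟨i, rfl⟩ := Nat.exists_eq_succ_of_ne_zero h0.ne'
    refine ⟨q % r, Nat.mod_lt _ hr, Or.inr ⟨by omega, q / r, ?_⟩⟩
    have := Nat.mod_add_div q r
    nth_rewrite 1 [← this]
    ring

/-- The state `s` describes the number with the digit sequence `η` of length `n` and the
exponents `a`, `b`, `c`. -/
structure Tracks (n : ℕ) (η : ℕ → ℕ) (a b c : ℕ) (s : State) : Prop where
  t_pos : 0 < s.t
  j_le : s.j ≤ n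
  b_eq : s.b = b
  k_eq : s.k = n % s.t
  low_eq : s.low = ∑ i ∈ Finset.range s.j, η i * 10 ^ i
  N₁_eq : s.N₁ = powSum (places η n s.j 1) (· % s.t)
  N₂_eq : s.N₂ = powSum (places η n s.j 2) (· % s.t)
  N₃_eq : s.N₃ = powSum (places η n s.j 3) (· % s.t)
  N₄_eq : s.N₄ = powSum (places η n s.j 4) (· % s.t)
  a_rep : Represents s.L a s.a
  c_rep : Represents s.L c s.c
  T_eq : s.T = 9 * (3 ^ s.a * (5 ^ s.b * 7 ^ s.c))

theorem anyDigit_of_eq {η : ℕ → ℕ} {n j δ t low : ℕ} {g : ℕ → ℕ → Bool} (hj : j < n)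
    (hcard : (places η n 0 δ).card ≤ 9) (h : η j = δ)
    (hg : g (powSum (places η n (j + 1) δ) (· % t)) (low + δ * 10 ^ j) = true) :
    anyDigit (10 ^ (j % t)) (powSum (places η n j δ) (· % t)) j low δ g = true := by
  have h1 : powSum (places η n j δ) (· % t) / 10 ^ (j % t) % 10 ≠ 0 := by
    rw [powSum_div_mod ((card_places_le η n j δ).trans hcard), Finset.card_ne_zero]
    exact ⟨j, Finset.mem_filter.mpr ⟨places_of_eq hj h, rfl⟩⟩
  have h2 : Nat.beq (Nat.mod (Nat.div (powSum (places η n j δ) (· % t)) (10 ^ (j % t))) 10) 0 =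
      false := by
    rw [← Bool.not_eq_true]
    exact fun h => h1 (Nat.eq_of_beq_eq_true h)
  have h3 : Nat.sub (powSum (places η n j δ) (· % t)) (10 ^ (j % t)) =
      powSum (places η n (j + 1) δ) (· % t) := by
    rw [powSum_places_of_eq _ hj h]
    exact Nat.add_sub_cancel_left _ _
  rw [anyDigit, choose_eq, h2, cond_false, force_eq, force_eq, h3]
  exact hg

section
variable {n a b c : ℕ} {η : ℕ → ℕ}

theorem anyRefinement_of_digit {s : State} {g : State → Bool} (hs : Tracks n η a b c s)
    (hn : 7 ≤ n) (hη : ∀ i, η i ≤ 4) (hcard : ∀ δ, 1 ≤ δ → (places η n 0 δ).card ≤ 9)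
    (hg : ∀ s', Tracks n η a b c s' → s'.t = s.t → s'.L = s.L → g s' = true) :
    anyRefinement s g .digit = true := by
  obtain ⟨t, L, j, b', k, low, N₁, N₂, N₃, N₄, a', c', T⟩ := s
  obtain ⟨ht, hjn, hb, hk, hlow, h1, h2, h3, h4, ha, hc, hT⟩ := hs
  dsimp only at *
  subst h1 h2 h3 h4
  simp only [anyRefinement, force_eq, choose_true_right, Bool.or_eq_true]
  by_cases hj7 : 7 ≤ j
  · exact Or.inl (Nat.ble_eq.mpr hj7)
  refine Or.inr ?_
  have hj : j < n := by omega
  have hlow' : low + η j * 10 ^ j = ∑ i ∈ Finset.range (j + 1), η i * 10 ^ i := by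
    rw [Finset.sum_range_succ, hlow]
  have hrest : ∀ {δ}, η j ≠ δ → powSum (places η n j δ) (· % t) =
      powSum (places η n (j + 1) δ) (· % t) := fun h => by rw [places_of_ne hj h]
  have hcases : η j = 0 ∨ η j = 1 ∨ η j = 2 ∨ η j = 3 ∨ η j = 4 := by have := hη j; omega
  rcases hcases with h | h | h | h | h
  · refine Or.inl (hg _ ⟨ht, hj, hb, hk, ?_, hrest ?_, hrest ?_, hrest ?_, hrest ?_, ha, hc, hT⟩
      rfl rfl) <;> first | omega | skip
    rw [← hlow', h]
    simp
  · refine Or.inr (Or.inl (anyDigit_of_eq hj (hcard _ (by omega)) h (hg _ ⟨ht, hj, hb, hk, ?_,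
      rfl, hrest ?_, hrest ?_, hrest ?_, ha, hc, hT⟩ rfl rfl))) <;> first | omega | skip
    rw [← hlow', h]
  · refine Or.inr (Or.inr (Or.inl (anyDigit_of_eq hj (hcard _ (by omega)) h (hg _ ⟨ht, hj, hb, hk,
      ?_, hrest ?_, rfl, hrest ?_, hrest ?_, ha, hc, hT⟩ rfl rfl)))) <;> first | omega | skip
    rw [← hlow', h]
  · refine Or.inr (Or.inr (Or.inr (Or.inl (anyDigit_of_eq hj (hcard _ (by omega)) h (hg _ ⟨ht, hj,
      hb, hk, ?_, hrest ?_, hrest ?_, rfl, hrest ?_, ha, hc, hT⟩ rfl rfl))))) <;>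
      first | omega | skip
    rw [← hlow', h]
  · refine Or.inr (Or.inr (Or.inr (Or.inr (anyDigit_of_eq hj (hcard _ (by omega)) h (hg _ ⟨ht, hj,
      hb, hk, ?_, hrest ?_, hrest ?_, hrest ?_, rfl, ha, hc, hT⟩ rfl rfl))))) <;>
      first | omega | skip
    rw [← hlow', h]

theorem anyRefinement_of_period {s : State} {g : State → Bool} {r : ℕ} (hr : 0 < r)
    (hs : Tracks n η a b c s) (hcard : ∀ δ, 1 ≤ δ → (places η n 0 δ).card ≤ 9)
    (hg : ∀ s', Tracks n η a b c s' → s'.t = r * s.t → s'.L = s.L → g s' = true) :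
    anyRefinement s g (.period r) = true := by
  obtain ⟨t, L, j, b', k, low, N₁, N₂, N₃, N₄, a', c', T⟩ := s
  obtain ⟨ht, hjn, hb, hk, hlow, h1, h2, h3, h4, ha, hc, hT⟩ := hs
  dsimp only at *
  subst h1 h2 h3 h4
  simp only [anyRefinement, force_eq]
  have hrt : 0 < r * t := Nat.mul_pos hr ht
  have hspread : ∀ {δ} {g' : ℕ → Bool}, 1 ≤ δ →
      g' (powSum (places η n j δ) (· % (r * t))) = true →
      anySpread t (Nat.pred r) (powSum (places η n j δ) (· % t)) g' = true := by
    intro δ g' hδ hg'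
    have h : powSum (places η n j δ) (· % t) = powSum (places η n j δ) (fun i => i % (r * t) % t) :=
      powSum_congr fun i _ => (Nat.mod_mul_left_mod i r t).symm
    rw [h]
    refine anySpread_of_powSum ht ((card_places_le η n j δ).trans (hcard δ hδ)) (fun i _ => ?_) hg'
    rw [show Nat.pred r + 1 = r from Nat.succ_pred_eq_of_pos hr]
    exact Nat.mod_lt _ hrt
  refine anyBelow_of_lt (i := n % (r * t) / t)
    (Nat.div_lt_of_lt_mul (by rw [mul_comm t]; exact Nat.mod_lt _ hrt)) ?_
  refine hspread (by norm_num) (hspread (by norm_num) (hspread (by norm_num)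
    (hspread (by norm_num) ?_)))
  refine hg _ ⟨hrt, hjn, hb, ?_, hlow, rfl, rfl, rfl, rfl, ha, hc, hT⟩ rfl rfl
  change k + n % (r * t) / t * t = n % (r * t)
  rw [hk, ← Nat.mod_mul_left_mod n r t]
  exact Nat.mod_add_div' _ _

theorem anyRefinement_of_exponents {s : State} {g : State → Bool} {r : ℕ} (hr : 0 < r)
    (hs : Tracks n η a b c s)
    (hg : ∀ s', Tracks n η a b c s' → s'.t = s.t → s'.L = r * s.L → g s' = true) :
    anyRefinement s g (.exponents r) = true := by
  obtain ⟨t, L, j, b', k, low, N₁, N₂, N₃, N₄, a', c', T⟩ := s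
  obtain ⟨ht, hjn, hb, hk, hlow, h1, h2, h3, h4, ha, hc, hT⟩ := hs
  dsimp only at *
  simp only [anyRefinement, force_eq]
  obtain ⟨x, hx, hxa⟩ := ha.exists_refinement hr
  obtain ⟨y, hy, hyc⟩ := hc.exists_refinement hr
  exact anyBelow_of_lt hx (anyBelow_of_lt hy
    (hg _ ⟨ht, hjn, hb, hk, hlow, h1, h2, h3, h4, hxa, hyc, rfl⟩ rfl rfl))

end

/-! ### Correctness of the sieve -/

/-- The conditions on the moduli of a stage with period `t` and exponents known modulo `L`: the
digit positions matter modulo `t` only, and the positive exponents modulo `L` only. The numbers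
`27 = 9 * 3` and `63 = 9 * 7` stand for the factor `9` and the first power of `3` or `7`. -/
def Stage.Valid (g : Stage) (t L : ℕ) : Prop :=
  (g.wordMod = 0 ∨ 3 * 3 ^ L ≡ 3 [MOD g.wordMod] ∧ 7 * 7 ^ L ≡ 7 [MOD g.wordMod]) ∧
    ∀ q ∈ g.tests, q.1 ∣ 10 ^ t - 1 ∧
      powChain q.2 q.1 (27 * 3 ^ L) = powChain q.2 q.1 27 ∧
      powChain q.2 q.1 (63 * 7 ^ L) = powChain q.2 q.1 63

/-- The exponent `a` may be replaced by its representative `a'`, if multiplication by `x ^ L` does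
not change the class of `(u * x) ^ e`. -/
theorem pow_modEq_of_represents {L x u m e a a' : ℕ}
    (hx : (u * x * x ^ L) ^ e ≡ (u * x) ^ e [MOD m])
    (h : Represents L a a') : (u * x ^ a) ^ e ≡ (u * x ^ a') ^ e [MOD m] := by
  rcases h with ⟨rfl, rfl⟩ | ⟨h0, q, rfl⟩
  · rfl
  · obtain ⟨i, rfl⟩ := Nat.exists_eq_succ_of_ne_zero h0.ne'
    induction q with
    | zero => rfl
    | succ q ih =>
      refine Nat.ModEq.trans ?_ ih
      have h := hx.mul_right ((x ^ (i + L * q)) ^ e)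
      rw [← mul_pow, ← mul_pow] at h
      convert h using 2 <;> rw [Nat.succ_eq_add_one] <;> ring

section
variable {n a b c : ℕ} {η : ℕ → ℕ}

theorem ten_pow_mod_modEq (t i : ℕ) : 10 ^ (i % t) ≡ 10 ^ i [MOD 10 ^ t - 1] := by
  have h : 10 ^ t ≡ 1 [MOD 10 ^ t - 1] :=
    (Nat.modEq_iff_dvd' (Nat.one_le_pow _ _ (by norm_num))).mpr dvd_rfl |>.symm
  conv_rhs => rw [← Nat.mod_add_div i t, pow_add, pow_mul]
  simpa using (Nat.ModEq.mul_left (10 ^ (i % t)) (h.pow (i / t))).symm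

theorem powSum_mod_modEq (S : Finset ℕ) (t : ℕ) :
    powSum S (· % t) ≡ ∑ i ∈ S, 10 ^ i [MOD 10 ^ t - 1] := by
  unfold powSum
  induction S using Finset.induction_on with
  | empty => rfl
  | insert i S hi ih =>
    rw [Finset.sum_insert hi, Finset.sum_insert hi]
    exact (ten_pow_mod_modEq t i).add ih

theorem sum_Ico_eq_places (hη : ∀ i, η i ≤ 4) (j : ℕ) :
    ∑ i ∈ Finset.Ico j n, η i * 10 ^ i =
      ∑ i ∈ places η n j 1, 10 ^ i + (2 * ∑ i ∈ places η n j 2, 10 ^ i +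
        (3 * ∑ i ∈ places η n j 3, 10 ^ i + 4 * ∑ i ∈ places η n j 4, 10 ^ i)) := by
  simp only [places, Finset.sum_filter, Finset.mul_sum, ← Finset.sum_add_distrib]
  refine Finset.sum_congr rfl fun i _ => ?_
  have hcases : η i = 0 ∨ η i = 1 ∨ η i = 2 ∨ η i = 3 ∨ η i = 4 := by have := hη i; omega
  rcases hcases with h | h | h | h | h <;> simp [h]

theorem sum_Ico_modEq_zero (η : ℕ → ℕ) (n j : ℕ) :
    ∑ i ∈ Finset.Ico j n, η i * 10 ^ i ≡ 0 [MOD 10 ^ j] := by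
  refine (Nat.modEq_zero_iff_dvd).mpr (Finset.dvd_sum fun i hi => ?_)
  exact Dvd.dvd.mul_left (pow_dvd_pow _ (Finset.mem_Ico.mp hi).1) _

/-- The last `j` digits of the number are compared with the product of powers. -/
theorem Tracks.low_modEq {s : State} {m : ℕ} (hs : Tracks n η a b c s)
    (hm3 : 3 * 3 ^ s.L ≡ 3 [MOD m]) (hm7 : 7 * 7 ^ s.L ≡ 7 [MOD m])
    (heq : 9 * (3 ^ a * (5 ^ b * 7 ^ c)) + 1 = 10 ^ n + 18 * ∑ i ∈ Finset.range n, η i * 10 ^ i) :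
    s.T + 1 ≡ 18 * s.low [MOD Nat.gcd (m * 5 ^ s.b) (10 ^ s.j)] := by
  have h3 : 3 ^ a ≡ 3 ^ s.a [MOD m] := by
    simpa using pow_modEq_of_represents (u := 1) (e := 1) (by simpa using hm3) hs.a_rep
  have h7 : 7 ^ c ≡ 7 ^ s.c [MOD m] := by
    simpa using pow_modEq_of_represents (u := 1) (e := 1) (by simpa using hm7) hs.c_rep
  have h : s.T ≡ 9 * (3 ^ a * (5 ^ b * 7 ^ c)) [MOD m * 5 ^ s.b] := by
    rw [hs.T_eq, ← hs.b_eq]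
    have h := (((h3.mul h7).mul_right' (5 ^ s.b)).mul_left 9).symm
    convert h using 1 <;> ring
  refine ((h.of_dvd (Nat.gcd_dvd_left _ _)).add_right 1).trans ?_
  rw [heq]
  have h10 : 10 ^ n ≡ 0 [MOD 10 ^ s.j] := (Nat.modEq_zero_iff_dvd).mpr (pow_dvd_pow _ hs.j_le)
  have hsum := h10.add (((sum_Ico_modEq_zero η n s.j).add_left s.low).mul_left 18)
  rw [hs.low_eq, Finset.sum_range_add_sum_Ico _ hs.j_le, zero_add, add_zero, ← hs.low_eq] at hsum
  exact hsum.of_dvd (Nat.gcd_dvd_right _ _)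

/-- The number and the product of powers agree modulo the divisors of `10 ^ t - 1`. -/
theorem Tracks.congruent_of_dvd {s : State} {q e : ℕ} (hs : Tracks n η a b c s)
    (hη : ∀ i, η i ≤ 4) (hq : q ∣ 10 ^ s.t - 1)
    (h3 : (27 * 3 ^ s.L) ^ e ≡ 27 ^ e [MOD q]) (h7 : (63 * 7 ^ s.L) ^ e ≡ 63 ^ e [MOD q])
    (heq : 9 * (3 ^ a * (5 ^ b * 7 ^ c)) + 1 = 10 ^ n + 18 * ∑ i ∈ Finset.range n, η i * 10 ^ i) :
    (10 ^ s.k - 1 + 18 * (s.low + (s.N₁ + (2 * s.N₂ + (3 * s.N₃ + 4 * s.N₄))))) ^ e ≡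
      s.T ^ e [MOD q] := by
  have hV : 10 ^ s.k - 1 + 18 * (s.low + (s.N₁ + (2 * s.N₂ + (3 * s.N₃ + 4 * s.N₄)))) ≡
      9 * (3 ^ a * (5 ^ b * 7 ^ c)) [MOD q] := by
    refine Nat.ModEq.of_dvd hq (Nat.ModEq.add_right_cancel' 1 ?_)
    rw [heq, ← Finset.sum_range_add_sum_Ico _ hs.j_le, ← hs.low_eq, sum_Ico_eq_places hη,
      add_right_comm, Nat.sub_add_cancel (Nat.one_le_pow _ _ (by norm_num)), hs.k_eq,
      hs.N₁_eq, hs.N₂_eq, hs.N₃_eq, hs.N₄_eq]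
    exact (ten_pow_mod_modEq _ _).add (((powSum_mod_modEq _ _).add
      (((powSum_mod_modEq _ _).mul_left 2).add (((powSum_mod_modEq _ _).mul_left 3).add
        ((powSum_mod_modEq _ _).mul_left 4)))).add_left _ |>.mul_left 18)
  refine (hV.pow e).trans ?_
  have h3' := pow_modEq_of_represents (u := 9) (x := 3) h3 hs.a_rep
  have h7' := pow_modEq_of_represents (u := 9) (x := 7) h7 hs.c_rep
  rw [hs.T_eq, ← hs.b_eq]
  have h1 := h3'.mul_right ((5 ^ s.b * 7 ^ c) ^ e)
  have h2 := h7'.mul_right ((5 ^ s.b * 3 ^ s.a) ^ e)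
  rw [← mul_pow, ← mul_pow] at h1 h2
  have h1' : 9 * 3 ^ s.a * (5 ^ s.b * 7 ^ c) = 9 * 7 ^ c * (5 ^ s.b * 3 ^ s.a) := by ring
  rw [h1'] at h1
  convert h1.trans h2 using 2 <;> ring

theorem congruent_of_forall {V T : ℕ} {qs : List (ℕ × List ℕ)}
    (h : ∀ q ∈ qs, V ^ q.2.prod ≡ T ^ q.2.prod [MOD q.1]) : congruent V T qs = true := by
  induction qs with
  | nil => rfl
  | cons q qs ih =>
    change choose (Nat.beq (powChain q.2 q.1 V) (powChain q.2 q.1 T)) (congruent V T qs) false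
      = true
    rw [choose_false_right, Bool.and_eq_true]
    refine ⟨?_, ih fun q' hq' => h q' (List.mem_cons_of_mem _ hq')⟩
    rw [powChain_eq, powChain_eq, h q List.mem_cons_self, Nat.beq_refl]

/-- A state that describes a solution passes every test. -/
theorem passes_of_tracks {s : State} {g : Stage} (hs : Tracks n η a b c s)
    (hη : ∀ i, η i ≤ 4) (hg : g.Valid s.t s.L)
    (heq : 9 * (3 ^ a * (5 ^ b * 7 ^ c)) + 1 = 10 ^ n + 18 * ∑ i ∈ Finset.range n, η i * 10 ^ i) :
    passes g s = true := by
  have hlow : g.wordMod = 0 ∨ s.T + 1 ≡ 18 * s.low [MOD Nat.gcd (g.wordMod * 5 ^ s.b) (10 ^ s.j)] :=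
    hg.1.imp_right fun h => hs.low_modEq h.1 h.2 heq
  have hcong : congruent (10 ^ s.k - 1 + 18 * (s.low + (s.N₁ + (2 * s.N₂ + (3 * s.N₃ + 4 * s.N₄)))))
      s.T g.tests = true := congruent_of_forall fun q hq => by
    obtain ⟨h, h3, h7⟩ := hg.2 q hq
    rw [powChain_eq, powChain_eq] at h3 h7
    exact hs.congruent_of_dvd hη h h3 h7 heq
  obtain ⟨t, L, j, b', k, low, N₁, N₂, N₃, N₄, a', c', T⟩ := s
  obtain ⟨ref, m, qs⟩ := g
  change choose (choose (Nat.beq m 0) true (force _ fun w =>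
    Nat.beq (Nat.mod (Nat.succ T) w) (Nat.mod (Nat.mul 18 low) w))) (force _ fun V =>
      congruent V T qs) false = true
  rw [choose_false_right, choose_true_right, force_eq, force_eq, Bool.and_eq_true, Bool.or_eq_true]
  exact ⟨hlow.imp (fun h => Nat.beq_eq.mpr h) (fun h => Nat.beq_eq.mpr h), hcong⟩

/-- The period and the exponent modulus after a refinement. -/
def Refinement.next (t L : ℕ) : Refinement → ℕ × ℕ
  | .digit => (t, L)
  | .period r => (r * t, L)
  | .exponents r => (t, r * L)

/-- The factor of a refinement is positive. -/
def Refinement.Proper : Refinement → Prop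
  | .digit => True
  | .period r => 0 < r
  | .exponents r => 0 < r

/-- All stages satisfy their conditions, if the period and the exponent modulus are `t` and `L` at
the beginning. -/
def ValidFrom : ℕ → ℕ → List Stage → Prop
  | _, _, [] => True
  | t, L, g :: gs => g.refinement.Proper ∧
      g.Valid (g.refinement.next t L).1 (g.refinement.next t L).2 ∧
      ValidFrom (g.refinement.next t L).1 (g.refinement.next t L).2 gs

noncomputable instance (g : Stage) (t L : ℕ) : Decidable (g.Valid t L) := by
  unfold Stage.Valid
  infer_instance

instance (ref : Refinement) : Decidable ref.Proper := by
  cases ref <;> unfold Refinement.Proper <;> infer_instance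

noncomputable instance decidableValidFrom (gs : List Stage) (t L : ℕ) :
    Decidable (ValidFrom t L gs) := by
  induction gs generalizing t L with
  | nil => exact instDecidableTrue
  | cons g gs ih =>
    have := ih (g.refinement.next t L).1 (g.refinement.next t L).2
    unfold ValidFrom
    infer_instance

/-- A solution with at least seven digits is not lost by the sieve. -/
theorem survives_of_tracks {gs : List Stage} {s : State} (hn : 7 ≤ n) (hη : ∀ i, η i ≤ 4)
    (hcard : ∀ δ, 1 ≤ δ → (places η n 0 δ).card ≤ 9)
    (heq : 9 * (3 ^ a * (5 ^ b * 7 ^ c)) + 1 = 10 ^ n + 18 * ∑ i ∈ Finset.range n, η i * 10 ^ i)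
    (hgs : ValidFrom s.t s.L gs) (hs : Tracks n η a b c s) : survives gs s = true := by
  induction gs generalizing s with
  | nil => rfl
  | cons g gs ih =>
    obtain ⟨ref, m, qs⟩ := g
    obtain ⟨hr, hg, hgs⟩ := hgs
    change anyRefinement s (fun s' => choose (passes ⟨ref, m, qs⟩ s') (survives gs s') false) ref
      = true
    have key : ∀ s', Tracks n η a b c s' → (s'.t, s'.L) = ref.next s.t s.L →
        choose (passes ⟨ref, m, qs⟩ s') (survives gs s') false = true := by
      intro s' hs' h
      rw [choose_false_right, Bool.and_eq_true]
      dsimp only at hg hgs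
      rw [← h] at hg hgs
      exact ⟨passes_of_tracks hs' hη hg heq, ih hgs hs'⟩
    cases ref with
    | digit =>
      exact anyRefinement_of_digit hs hn hη hcard fun s' hs' ht hL => key s' hs' (by
        rw [ht, hL]; rfl)
    | period r =>
      exact anyRefinement_of_period hr hs hcard fun s' hs' ht hL => key s' hs' (by
        rw [ht, hL]; rfl)
    | exponents r =>
      exact anyRefinement_of_exponents hr hs fun s' hs' ht hL => key s' hs' (by
        rw [ht, hL]; rfl)

theorem validFrom_sieve : ValidFrom 1 1 sieve := by decide +kernel

/-- Numbers with at least seven digits, all of them odd, are not, if the digits other than `1` are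
of an excluded type, of the form `3 ^ a * (5 ^ b * 7 ^ c)` with `1 ≤ b ≤ 5`. -/
theorem sieve_contradiction {n₁ n₂ n₃ n₄ : ℕ} (hex : excluded n₁ n₂ n₃ n₄ = true)
    (hn : 7 ≤ n) (hη : ∀ i, η i ≤ 4) (hb : 1 ≤ b) (hb' : b ≤ 5)
    (h1 : (places η n 0 1).card = n₁) (h2 : (places η n 0 2).card = n₂)
    (h3 : (places η n 0 3).card = n₃) (h4 : (places η n 0 4).card = n₄)
    (hcard : n₁ ≤ 9 ∧ n₂ ≤ 9 ∧ n₃ ≤ 9 ∧ n₄ ≤ 9) :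
    9 * (3 ^ a * (5 ^ b * 7 ^ c)) + 1 ≠ 10 ^ n + 18 * ∑ i ∈ Finset.range n, η i * 10 ^ i := by
  intro heq
  have hrep : ∀ a : ℕ, ∃ x < 2, Represents 1 a x := fun a => by
    rcases Nat.eq_zero_or_pos a with rfl | h
    · exact ⟨0, by norm_num, Or.inl ⟨rfl, rfl⟩⟩
    · exact ⟨1, by norm_num, Or.inr ⟨one_pos, a - 1, by omega⟩⟩
  have hsum : ∀ S : Finset ℕ, S.card = powSum S (· % 1) := fun S => by
    simp [powSum, Nat.mod_one]
  obtain ⟨x, hx, hax⟩ := hrep a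
  obtain ⟨y, hy, hcy⟩ := hrep c
  have hcard' : ∀ δ, 1 ≤ δ → (places η n 0 δ).card ≤ 9 := fun δ hδ => by
    have h : δ = 1 ∨ δ = 2 ∨ δ = 3 ∨ δ = 4 ∨ 5 ≤ δ := by omega
    rcases h with rfl | rfl | rfl | rfl | h
    iterate 4 omega
    rw [show places η n 0 δ = ∅ from Finset.filter_eq_empty_iff.mpr fun i _ => by
      have := hη i; omega]
    simp
  have hs : Tracks n η a b c ⟨1, 1, 0, b - 1 + 1, 0, 0, n₁, n₂, n₃, n₄, x, y,
      9 * (3 ^ x * (5 ^ (b - 1 + 1) * 7 ^ y))⟩ :=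
    ⟨one_pos, Nat.zero_le _, Nat.sub_add_cancel hb, (Nat.mod_one n).symm, by simp,
      h1.symm.trans (hsum _), h2.symm.trans (hsum _), h3.symm.trans (hsum _),
      h4.symm.trans (hsum _), hax, hcy, rfl⟩
  have hsurv := survives_of_tracks hn hη hcard' heq validFrom_sieve hs
  have hy' := anyBelow_of_lt (g := fun y => survives sieve ⟨1, 1, 0, b - 1 + 1, 0, 0, n₁, n₂, n₃,
    n₄, x, y, 9 * (3 ^ x * (5 ^ (b - 1 + 1) * 7 ^ y))⟩) hy hsurv
  have hx' := anyBelow_of_lt (g := fun x => anyBelow 2 fun y => survives sieve ⟨1, 1, 0, b - 1 + 1,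
    0, 0, n₁, n₂, n₃, n₄, x, y, 9 * (3 ^ x * (5 ^ (b - 1 + 1) * 7 ^ y))⟩) hx hy'
  have hb'' := anyBelow_of_lt (g := fun i => anyBelow 2 fun x => anyBelow 2 fun y => survives sieve
    ⟨1, 1, 0, i + 1, 0, 0, n₁, n₂, n₃, n₄, x, y, 9 * (3 ^ x * (5 ^ (i + 1) * 7 ^ y))⟩)
    (show b - 1 < 5 by omega) hx'
  rw [excluded, hb''] at hex
  exact absurd hex (by decide)

end

/-! ### Numbers with odd decimal digits -/

theorem decDigits_of_pos {n : ℕ} (hn : 0 < n) : decDigits n = Nat.digits 10 n :=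
  if_neg hn.ne'

theorem f_of_le_nine {n : ℕ} (hn : n ≤ 9) : f n = n := by
  rcases Nat.eq_zero_or_pos n with rfl | h
  · rfl
  · rw [f, decDigits_of_pos h, Nat.digits_of_lt 10 n h.ne' (by omega), List.prod_singleton]

theorem mod_ten_mem_decDigits (n : ℕ) : n % 10 ∈ decDigits n := by
  rcases Nat.eq_zero_or_pos n with rfl | h
  · simp [decDigits]
  · rw [decDigits_of_pos h, Nat.digits_def' (by norm_num) h]
    exact List.mem_cons_self

theorem div_ten_mod_ten_mem_decDigits {n : ℕ} (hn : 10 ≤ n) : n / 10 % 10 ∈ decDigits n := by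
  rw [decDigits_of_pos (by omega), Nat.digits_def' (by norm_num) (by omega),
    ← decDigits_of_pos (show 0 < n / 10 by omega)]
  exact List.mem_cons_of_mem _ (mod_ten_mem_decDigits _)

theorem dvd_f_of_mem {n x : ℕ} (hx : x ∈ decDigits n) : x ∣ f n := List.dvd_prod hx

theorem decDigits_lt_ten {n x : ℕ} (hx : x ∈ decDigits n) : x < 10 := by
  rcases Nat.eq_zero_or_pos n with rfl | h
  · simp [decDigits] at hx
    omega
  · rw [decDigits_of_pos h] at hx
    exact Nat.digits_lt_base (by norm_num) hx

theorem odd_of_mem_decDigits {n x : ℕ} (h : Odd (f n)) (hx : x ∈ decDigits n) : Odd x :=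
  h.of_dvd_nat (dvd_f_of_mem hx)

theorem decDigits_mem_of_odd {n x : ℕ} (h : Odd (f n)) (hx : x ∈ decDigits n) :
    x ∈ ({1, 3, 5, 7, 9} : Set ℕ) := by
  have h1 := decDigits_lt_ten hx
  obtain ⟨k, rfl⟩ := odd_of_mem_decDigits h hx
  simp only [Set.mem_insert_iff, Set.mem_singleton_iff]
  omega

theorem odd_of_odd_f {n : ℕ} (h : Odd (f n)) : Odd n := by
  have := odd_of_mem_decDigits h (mod_ten_mem_decDigits n)
  rw [Nat.odd_iff] at this ⊢
  omega

theorem list_prod_eq_of_mem {l : List ℕ} (h : ∀ x ∈ l, x ∈ ({1, 3, 5, 7, 9} : Set ℕ)) :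
    l.prod = 3 ^ (l.count 3 + 2 * l.count 9) * 5 ^ l.count 5 * 7 ^ l.count 7 := by
  induction l with
  | nil => simp
  | cons x l ih =>
    rw [List.prod_cons, ih fun y hy => h y (List.mem_cons_of_mem _ hy)]
    have hx := h x List.mem_cons_self
    simp only [Set.mem_insert_iff, Set.mem_singleton_iff] at hx
    rcases hx with rfl | rfl | rfl | rfl | rfl <;> simp <;> ring

theorem f_eq_of_odd {n : ℕ} (h : Odd (f n)) :
    f n = 3 ^ ((decDigits n).count 3 + 2 * (decDigits n).count 9) * 5 ^ (decDigits n).count 5 *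
      7 ^ (decDigits n).count 7 :=
  list_prod_eq_of_mem fun _ hx => decDigits_mem_of_odd h hx

/-- A number whose digits are `2 * h + 1` is the repunit of the same length plus twice the number
with the digits `h`. -/
theorem nine_mul_ofDigits_add_one {l : List ℕ} (h : ∀ x ∈ l, Odd x) :
    9 * Nat.ofDigits 10 l + 1 =
      10 ^ l.length + 18 * ∑ i ∈ Finset.range l.length, l.getD i 0 / 2 * 10 ^ i := by
  induction l with
  | nil => simp
  | cons x l ih =>
    have ih := ih fun y hy => h y (List.mem_cons_of_mem _ hy)
    obtain ⟨k, hk⟩ := h x List.mem_cons_self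
    rw [Nat.ofDigits_cons, List.length_cons, Finset.sum_range_succ']
    simp only [List.getD_cons_succ, List.getD_cons_zero, pow_succ, pow_zero, ← mul_assoc,
      ← Finset.sum_mul]
    omega

theorem card_places_eq_count {l : List ℕ} (h : ∀ x ∈ l, Odd x) (δ : ℕ) :
    (places (fun i => l.getD i 0 / 2) l.length 0 δ).card = l.count (2 * δ + 1) := by
  rw [places, Finset.card_filter, ← Finset.range_eq_Ico]
  induction l with
  | nil => simp
  | cons x l ih =>
    have ih := ih fun y hy => h y (List.mem_cons_of_mem _ hy)
    obtain ⟨k, hk⟩ := h x List.mem_cons_self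
    rw [List.length_cons, Finset.sum_range_succ', List.count_cons]
    simp only [List.getD_cons_succ, List.getD_cons_zero]
    rw [ih, hk]
    congr 1
    simp only [beq_iff_eq]
    congr 1
    apply propext
    omega

/-- The product of the last `k` digits. -/
def lowProd : ℕ → ℕ → ℕ
  | 0, _ => 1
  | k + 1, n => n % 10 * lowProd k (n / 10)

theorem lowProd_dvd_f {k n : ℕ} (hn : 10 ^ k ≤ n) : lowProd k n ∣ f n := by
  induction k generalizing n with
  | zero => exact one_dvd _
  | succ k ih =>
    have h1 : 10 ^ k ≤ n / 10 := by rw [Nat.le_div_iff_mul_le (by norm_num), ← pow_succ]; exact hn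
    have h2 : 0 < n / 10 := (Nat.pow_pos (by norm_num)).trans_le h1
    rw [f, decDigits_of_pos (by omega), Nat.digits_def' (by norm_num) (by omega),
      ← decDigits_of_pos h2, List.prod_cons]
    exact mul_dvd_mul_left _ (ih h1)

theorem lowProd_mod (k n : ℕ) : lowProd k (n % 10 ^ k) = lowProd k n := by
  induction k generalizing n with
  | zero => rfl
  | succ k ih =>
    rw [lowProd, lowProd, ← ih (n / 10), pow_succ', Nat.mod_mul_right_mod,
      Nat.mod_mul_right_div_self]

/-! ### The preimages of the vertices of the tree of `5` -/

/-- The vertices of the tree of `5`. -/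
def verticesFive : List ℕ := [5, 15, 35, 135, 315, 75, 175, 1715, 1575, 77175, 3375, 59535]

/-- The edges of the tree of `5`. -/
def edgesFive : List (ℕ × ℕ) := [(5, 5), (5, 15), (15, 315), (15, 135), (15, 35), (315, 3375),
  (3375, 59535), (35, 1715), (35, 175), (35, 75), (1715, 77175), (175, 1575)]

theorem mem_graphFive_verts {s : ℕ} : s ∈ graphFive.verts ↔ s ∈ verticesFive := by
  simp [graphFive, verticesFive]

theorem mem_graphFive_edges {e : ℕ × ℕ} : e ∈ graphFive.edges ↔ e ∈ edgesFive := by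
  simp [graphFive, edgesFive]

/-- The numbers of digits `3`, `5`, `7`, `9` in the numbers with digit product in the tree of
`5`. -/
def digitTypes : List (ℕ × ℕ × ℕ × ℕ) :=
  [(0, 1, 0, 0), (1, 1, 0, 0), (0, 1, 1, 0), (3, 1, 0, 0), (1, 1, 0, 1), (2, 1, 1, 0), (0, 1, 1, 1),
   (1, 2, 0, 0), (0, 2, 1, 0), (0, 1, 3, 0), (2, 2, 1, 0), (0, 2, 1, 1), (2, 2, 3, 0), (0, 2, 3, 1),
   (3, 3, 0, 0), (1, 3, 0, 1), (5, 1, 2, 0), (3, 1, 2, 1), (1, 1, 2, 2)]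

theorem excluded_of_mem : ∀ p ∈ digitTypes, excluded p.1 p.2.1 p.2.2.1 p.2.2.2 = true := by
  decide +kernel

-- The decidability instance of the finite check is deeply nested.
set_option synthInstance.maxHeartbeats 0 in
set_option synthInstance.maxSize 10000 in
theorem mem_digitTypes {n₁ n₂ n₃ n₄ : ℕ} (h : 3 ^ (n₁ + 2 * n₄) * 5 ^ n₂ * 7 ^ n₃ ∈ verticesFive) :
    (n₁, n₂, n₃, n₄) ∈ digitTypes := by
  have hle : 3 ^ (n₁ + 2 * n₄) * 5 ^ n₂ * 7 ^ n₃ ≤ 77175 :=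
    (show ∀ s ∈ verticesFive, s ≤ 77175 by decide) _ h
  have h3 : 3 ^ (n₁ + 2 * n₄) < 3 ^ 11 :=
    ((Nat.le_of_dvd (by positivity) ⟨5 ^ n₂ * 7 ^ n₃, by ring⟩).trans hle).trans_lt (by norm_num)
  have h5 : 5 ^ n₂ < 5 ^ 7 :=
    ((Nat.le_of_dvd (by positivity) ⟨3 ^ (n₁ + 2 * n₄) * 7 ^ n₃, by ring⟩).trans hle).trans_lt
      (by norm_num)
  have h7 : 7 ^ n₃ < 7 ^ 6 :=
    ((Nat.le_of_dvd (by positivity) ⟨3 ^ (n₁ + 2 * n₄) * 5 ^ n₂, by ring⟩).trans hle).trans_lt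
      (by norm_num)
  have h3 := (Nat.pow_lt_pow_iff_right (by norm_num)).mp h3
  have h5 := (Nat.pow_lt_pow_iff_right (by norm_num)).mp h5
  have h7 := (Nat.pow_lt_pow_iff_right (by norm_num)).mp h7
  -- The bounds on the exponents reduce the claim to finitely many cases.
  have key : ∀ n₁ < 11, ∀ n₄ < 6, ∀ n₂ < 7, ∀ n₃ < 6,
      3 ^ (n₁ + 2 * n₄) * 5 ^ n₂ * 7 ^ n₃ ∈ verticesFive → (n₁, n₂, n₃, n₄) ∈ digitTypes := by
    decide +kernel
  exact key _ (by omega) _ (by omega) _ h5 _ h7 h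

theorem odd_of_mem_verticesFive : ∀ s ∈ verticesFive, Odd s := by decide

theorem five_dvd_of_mem_verticesFive : ∀ s ∈ verticesFive, 5 ∣ s := by decide

/-- The last six digits of a multiple of `5 ^ 6` leave `64` possibilities, and the digit product
never divides a vertex of the tree. -/
theorem lt_six_of_f_mem {a b c : ℕ} (hm : 10 ^ 6 ≤ 3 ^ a * (5 ^ b * 7 ^ c))
    (h : f (3 ^ a * (5 ^ b * 7 ^ c)) ∈ verticesFive) : b < 6 := by
  by_contra! hb
  have hdvd : 5 ^ 6 ∣ 3 ^ a * (5 ^ b * 7 ^ c) :=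
    Dvd.dvd.mul_left (Dvd.dvd.mul_right (pow_dvd_pow 5 hb) _) _
  have key : ∀ j < 64, ∀ s ∈ verticesFive, ¬ lowProd 6 (5 ^ 6 * j) ∣ s := by decide +kernel
  generalize 3 ^ a * (5 ^ b * 7 ^ c) = m at *
  obtain ⟨q, rfl⟩ := hdvd
  refine key (q % 64) (Nat.mod_lt _ (by norm_num)) _ h ?_
  rw [← Nat.mul_mod_mul_left]
  have := lowProd_mod 6 (5 ^ 6 * q)
  norm_num at this ⊢
  rw [this]
  exact lowProd_dvd_f hm

/-- The sieve bounds the preimages under `f` of the vertices of the tree. -/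
theorem lt_of_f_mem {a b c : ℕ} (hb : 1 ≤ b) (h : f (3 ^ a * (5 ^ b * 7 ^ c)) ∈ verticesFive) :
    3 ^ a * (5 ^ b * 7 ^ c) < 10 ^ 6 := by
  by_contra! hm
  have hb' := lt_six_of_f_mem hm h
  have hodd := odd_of_mem_verticesFive _ h
  have hmem : ∀ x ∈ decDigits (3 ^ a * (5 ^ b * 7 ^ c)), Odd x := fun x => odd_of_mem_decDigits hodd
  rw [f_eq_of_odd hodd] at h
  rw [decDigits_of_pos (by positivity)] at h hmem
  set l := Nat.digits 10 (3 ^ a * (5 ^ b * 7 ^ c)) with hl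
  have htype := mem_digitTypes h
  have hcard := (show ∀ p ∈ digitTypes, p.1 ≤ 9 ∧ p.2.1 ≤ 9 ∧ p.2.2.1 ≤ 9 ∧ p.2.2.2 ≤ 9 by
    decide) _ htype
  have hlen : 7 ≤ l.length := (Nat.lt_digits_length_iff (by norm_num) _).mpr hm
  have hdig : ∀ i, l.getD i 0 / 2 ≤ 4 := fun i => by
    have : l.getD i 0 < 10 := by
      rcases lt_or_ge i l.length with hi | hi
      · rw [List.getD_eq_getElem _ _ hi]
        exact Nat.digits_lt_base (by norm_num) (List.getElem_mem hi)
      · rw [List.getD_eq_default _ _ hi]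
        norm_num
    omega
  refine sieve_contradiction (n := l.length) (η := fun i => l.getD i 0 / 2)
    (excluded_of_mem _ htype) hlen hdig hb (by omega) (card_places_eq_count hmem 1)
    (card_places_eq_count hmem 2) (card_places_eq_count hmem 3) (card_places_eq_count hmem 4)
    hcard (a := a) (c := c) ?_
  rw [← nine_mul_ofDigits_add_one hmem, hl, Nat.ofDigits_digits]

set_option synthInstance.maxHeartbeats 400000 in
set_option synthInstance.maxSize 1000 in
theorem edge_of_f_mem {a b c : ℕ} (hb : 1 ≤ b) (h : f (3 ^ a * (5 ^ b * 7 ^ c)) ∈ verticesFive) :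
    (f (3 ^ a * (5 ^ b * 7 ^ c)), 3 ^ a * (5 ^ b * 7 ^ c)) ∈ edgesFive := by
  have hlt := lt_of_f_mem hb h
  have h3 : 3 ^ a < 3 ^ 13 :=
    ((Nat.le_of_dvd (by positivity) ⟨5 ^ b * 7 ^ c, by ring⟩).trans_lt hlt).trans (by norm_num)
  have h5 : 5 ^ b < 5 ^ 9 :=
    ((Nat.le_of_dvd (by positivity) ⟨3 ^ a * 7 ^ c, by ring⟩).trans_lt hlt).trans (by norm_num)
  have h7 : 7 ^ c < 7 ^ 8 :=
    ((Nat.le_of_dvd (by positivity) ⟨3 ^ a * 5 ^ b, by ring⟩).trans_lt hlt).trans (by norm_num)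
  have h3 := (Nat.pow_lt_pow_iff_right (by norm_num)).mp h3
  have h5 := (Nat.pow_lt_pow_iff_right (by norm_num)).mp h5
  have h7 := (Nat.pow_lt_pow_iff_right (by norm_num)).mp h7
  have key : ∀ a < 13, ∀ b < 9, ∀ c < 8, 1 ≤ b → f (3 ^ a * (5 ^ b * 7 ^ c)) ∈ verticesFive →
      (f (3 ^ a * (5 ^ b * 7 ^ c)), 3 ^ a * (5 ^ b * 7 ^ c)) ∈ edgesFive := by
    decide +kernel
  exact key a h3 b h5 c h7 hb h

/-! ### Target, height and the tree of antecedents -/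

theorem height_eq_zero {n : ℕ} (hn : n ≤ 9) : height n = 0 :=
  (Nat.find_eq_zero _).mpr hn

theorem height_eq_succ {n : ℕ} (hn : 9 < n) : height n = height (f n) + 1 :=
  Nat.find_comp_succ (exists_iterate_le_nine n) (exists_iterate_le_nine (f n)) (by simpa using hn)

theorem height_le {n k : ℕ} (h : f^[k] n ≤ 9) : height n ≤ k := Nat.find_min' _ h

theorem target_of_le_nine {n : ℕ} (hn : n ≤ 9) : target n = n := by
  rw [target, height_eq_zero hn, Function.iterate_zero_apply]

theorem target_le_nine (n : ℕ) : target n ≤ 9 := Nat.find_spec (exists_iterate_le_nine n)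

theorem target_f (n : ℕ) : target (f n) = target n := by
  rcases le_or_gt n 9 with h | h
  · rw [f_of_le_nine h]
  · rw [target, target, height_eq_succ h, Function.iterate_succ_apply]

/-- The tree of antecedents of a digit `d` consists of the digit products of the numbers with target
`d`. -/
theorem target_eq_iff {d : ℕ} (hd : d ≤ 9) (n : ℕ) : target n = d ↔ IsAntecedent d (f n) := by
  constructor
  · induction n using Nat.strong_induction_on with
    | _ n ih =>
      rintro rfl
      rcases le_or_gt n 9 with h | h
      · rw [target_of_le_nine h, f_of_le_nine h]
        exact .root
      · exact .step _ _ (ih (f n) (f_lt_self h) (target_f n)) rfl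
  · intro h
    rw [← target_f]
    generalize f n = s at h ⊢
    induction h with
    | root => exact target_of_le_nine hd
    | step s x _ hx ih => rw [← target_f, hx, ih]

/-! ### The trees of the odd digits -/

theorem three_pow_mul_seven_pow_mod (a c : ℕ) :
    3 ^ a * 7 ^ c % 20 ∈ ({1, 3, 7, 9} : Finset ℕ) := by
  have h3 : ∀ a, 3 ^ a % 20 ∈ ({1, 3, 7, 9} : Finset ℕ) := fun a => by
    induction a with
    | zero => decide
    | succ a ih =>
      rw [pow_succ, Nat.mul_mod]
      generalize 3 ^ a % 20 = r at ih
      revert r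
      decide
  induction c with
  | zero => simpa using h3 a
  | succ c ih =>
    rw [pow_succ, ← mul_assoc, Nat.mul_mod]
    generalize 3 ^ a * 7 ^ c % 20 = r at ih
    revert r
    decide

theorem lt_ten_of_odd_f {a c : ℕ} (h : Odd (f (3 ^ a * 7 ^ c))) : 3 ^ a * 7 ^ c < 10 := by
  by_contra! hm
  have hodd := odd_of_mem_decDigits h (div_ten_mod_ten_mem_decDigits hm)
  have hmod := three_pow_mul_seven_pow_mod a c
  simp only [Finset.mem_insert, Finset.mem_singleton] at hmod
  rw [Nat.odd_iff] at hodd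
  omega

theorem f_eq_of_f_f_eq {d x : ℕ} (hd : d ∈ ({1, 3, 7, 9} : Set ℕ)) (hx : f (f x) = d) :
    f x = d := by
  simp only [Set.mem_insert_iff, Set.mem_singleton_iff] at hd
  have hodd : Odd (f (f x)) := by
    rw [Nat.odd_iff]
    omega
  have hodd' := odd_of_odd_f hodd
  have heq := f_eq_of_odd hodd'
  rcases Nat.eq_zero_or_pos ((decDigits x).count 5) with h0 | h0
  · rw [h0, pow_zero, mul_one] at heq
    rw [heq] at hodd hx ⊢
    have := lt_ten_of_odd_f hodd
    rwa [f_of_le_nine (by omega)] at hx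
  · have h5 : 5 ∣ f x := by
      rw [heq]
      exact Dvd.dvd.mul_right (Dvd.dvd.mul_left (dvd_pow_self 5 h0.ne') _) _
    have hmod := mod_ten_mem_decDigits (f x)
    rw [show f x % 10 = 5 by rw [Nat.odd_iff] at hodd'; omega] at hmod
    have := dvd_f_of_mem hmod
    omega

theorem edge_of_f_f_mem {x : ℕ} (hx : f (f x) ∈ verticesFive) : (f (f x), f x) ∈ edgesFive := by
  have hodd := odd_of_mem_verticesFive _ hx
  have heq := f_eq_of_odd (odd_of_odd_f hodd)
  rw [mul_assoc] at heq
  rcases Nat.eq_zero_or_pos ((decDigits x).count 5) with h0 | h0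
  · rw [h0, pow_zero, one_mul] at heq
    rw [heq] at hodd hx
    have := lt_ten_of_odd_f hodd
    rw [f_of_le_nine (by omega)] at hx
    have h5 := five_dvd_of_mem_verticesFive _ hx
    rw [Nat.Prime.dvd_mul (by norm_num)] at h5
    rcases h5 with h5 | h5 <;> have := Nat.Prime.dvd_of_dvd_pow (by norm_num) h5 <;> omega
  · rw [heq] at hx ⊢
    exact edge_of_f_mem h0 hx

theorem snd_mem_of_mem_edgesFive : ∀ e ∈ edgesFive, e.2 ∈ verticesFive := by decide

theorem isAntecedent_five_iff {s : ℕ} : IsAntecedent 5 s ↔ s ∈ verticesFive := by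
  constructor
  · intro h
    induction h with
    | root => decide
    | step s x _ hx ih =>
      rw [← hx] at ih
      exact snd_mem_of_mem_edgesFive _ (edge_of_f_f_mem ih)
  · have step : ∀ {s} t x, IsAntecedent 5 s → f t = s → f x = t → IsAntecedent 5 t :=
      fun t x h ht hx => hx ▸ .step _ x h (by rw [hx, ht])
    -- Each vertex is the digit product of the number that follows it.
    have h15 := step 15 35 .root (by decide) (by decide)
    have h35 := step 35 57 h15 (by decide) (by decide)
    have h135 := step 135 3335 h15 (by decide) (by decide)
    have h315 := step 315 3357 h15 (by decide) (by decide)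
    have h75 := step 75 355 h35 (by decide) (by decide)
    have h175 := step 175 557 h35 (by decide) (by decide)
    have h1715 := step 1715 5777 h35 (by decide) (by decide)
    have h1575 := step 1575 33557 h175 (by decide) (by decide)
    have h77175 := step 77175 3355777 h1715 (by decide) (by decide +kernel)
    have h3375 := step 3375 333555 h315 (by decide) (by decide +kernel)
    have h59535 := step 59535 33333577 h3375 (by decide) (by decide +kernel)
    intro hs
    simp only [verticesFive, List.mem_cons, List.not_mem_nil, or_false] at hs
    rcases hs with rfl | rfl | rfl | rfl | rfl | rfl | rfl | rfl | rfl | rfl | rfl | rfl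
    exacts [.root, h15, h35, h135, h315, h75, h175, h1715, h1575, h77175, h3375, h59535]

theorem IsAntecedent.exists_f_eq {d s : ℕ} (hd : d ≤ 9) (h : IsAntecedent d s) : ∃ x, f x = s := by
  cases h with
  | root => exact ⟨d, f_of_le_nine hd⟩
  | step s x _ _ => exact ⟨x, rfl⟩

theorem antecedentTree_five : antecedentTree 5 = graphFive := by
  ext e
  · rw [mem_graphFive_verts]
    exact isAntecedent_five_iff
  · rw [mem_graphFive_edges]
    constructor
    · rintro ⟨h, x, hx, hx'⟩
      rw [isAntecedent_five_iff, ← hx] at h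
      have := edge_of_f_f_mem h
      rwa [hx, hx'] at this
    · intro he
      have h1 : ∀ e ∈ edgesFive, e.1 ∈ verticesFive := by decide
      have h2 : ∀ e ∈ edgesFive, f e.2 = e.1 := by decide +kernel
      obtain ⟨x, hx⟩ := IsAntecedent.exists_f_eq (by norm_num)
        (isAntecedent_five_iff.mpr (snd_mem_of_mem_edgesFive e he))
      exact ⟨isAntecedent_five_iff.mpr (h1 e he), x, by rw [hx, h2 e he], hx⟩

theorem le_nine_of_mem {d : ℕ} (hd : d ∈ ({1, 3, 7, 9} : Set ℕ)) : d ≤ 9 := by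
  simp only [Set.mem_insert_iff, Set.mem_singleton_iff] at hd
  omega

theorem isAntecedent_iff_eq {d s : ℕ} (hd : d ∈ ({1, 3, 7, 9} : Set ℕ)) :
    IsAntecedent d s ↔ s = d := by
  constructor
  · intro h
    induction h with
    | root => rfl
    | step s x _ hx ih => exact f_eq_of_f_f_eq hd (hx.trans ih)
  · rintro rfl
    exact .root

theorem antecedentTree_eq_loopGraph {d : ℕ} (hd : d ∈ ({1, 3, 7, 9} : Set ℕ)) :
    antecedentTree d = loopGraph d := by
  have hf := f_of_le_nine (le_nine_of_mem hd)
  ext e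
  · exact isAntecedent_iff_eq hd
  · change (IsAntecedent d e.1 ∧ ∃ x, f (f x) = e.1 ∧ f x = e.2) ↔ e = (d, d)
    rw [isAntecedent_iff_eq hd, Prod.ext_iff]
    constructor
    · rintro ⟨h, x, hx, hx'⟩
      exact ⟨h, hx' ▸ f_eq_of_f_f_eq hd (hx.trans h)⟩
    · rintro ⟨h, h'⟩
      exact ⟨h, d, by rw [hf, hf, h], by rw [hf, h']⟩

theorem antecedentTree_eq_explicitGraph {d : ℕ} (hd : d ∈ ({1, 3, 5, 7, 9} : Set ℕ)) :
    antecedentTree d = explicitGraph d := by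
  rw [explicitGraph]
  split_ifs with h
  · rw [h, antecedentTree_five]
  · refine antecedentTree_eq_loopGraph ?_
    simp only [Set.mem_insert_iff, Set.mem_singleton_iff] at hd ⊢
    omega

theorem target_eq_iff_mem {d : ℕ} (hd : d ∈ ({1, 3, 5, 7, 9} : Set ℕ)) (n : ℕ) :
    target n = d ↔ f n ∈ (explicitGraph d).verts := by
  rw [← antecedentTree_eq_explicitGraph hd]
  refine target_eq_iff ?_ n
  simp only [Set.mem_insert_iff, Set.mem_singleton_iff] at hd
  omega

theorem odd_of_mem_explicitGraph {d s : ℕ} (hd : d ∈ ({1, 3, 5, 7, 9} : Set ℕ))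
    (hs : s ∈ (explicitGraph d).verts) : Odd s := by
  rw [explicitGraph] at hs
  split_ifs at hs with h
  · exact odd_of_mem_verticesFive s (mem_graphFive_verts.mp hs)
  · obtain rfl : s = d := hs
    simp only [Set.mem_insert_iff, Set.mem_singleton_iff] at hd
    rw [Nat.odd_iff]
    omega

theorem mem_digitClass_of_odd {n : ℕ} (h : Odd (f n)) :
    n ∈ digitClass ((decDigits n).count 3) ((decDigits n).count 5) ((decDigits n).count 7)
      ((decDigits n).count 9) :=
  ⟨rfl, rfl, rfl, rfl, fun _ hx => decDigits_mem_of_odd h hx⟩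

theorem f_eq_of_mem_digitClass {n a b c d : ℕ} (h : n ∈ digitClass a b c d) :
    f n = 3 ^ (a + 2 * d) * 5 ^ b * 7 ^ c := by
  obtain ⟨rfl, rfl, rfl, rfl, h⟩ := h
  exact list_prod_eq_of_mem h

theorem setOf_target_eq {d : ℕ} (hd : d ∈ ({1, 3, 5, 7, 9} : Set ℕ)) :
    {n | target n = d} =
      ⋃ (α : ℕ) (β : ℕ) (γ : ℕ) (_ : 3 ^ α * 5 ^ β * 7 ^ γ ∈ (explicitGraph d).verts),
        ⋃ (α₁ : ℕ) (α₂ : ℕ) (_ : α₁ + 2 * α₂ = α), digitClass α₁ β γ α₂ := by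
  ext n
  simp only [Set.mem_ofPred_eq, Set.mem_iUnion, exists_prop, target_eq_iff_mem hd]
  constructor
  · intro h
    have hodd := odd_of_mem_explicitGraph hd h
    rw [f_eq_of_odd hodd] at h
    exact ⟨_, _, _, h, _, _, rfl, mem_digitClass_of_odd hodd⟩
  · rintro ⟨_, β, γ, h, α₁, α₂, rfl, hn⟩
    rwa [f_eq_of_mem_digitClass hn]

theorem height_le_one {d n : ℕ} (hd : d ∈ ({1, 3, 7, 9} : Set ℕ)) (hn : target n = d) :
    height n ≤ 1 := by
  rw [target_eq_iff (le_nine_of_mem hd), isAntecedent_iff_eq hd] at hn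
  exact height_le (hn.trans_le (le_nine_of_mem hd))

theorem height_le_five {n : ℕ} (hn : target n = 5) : height n ≤ 5 := by
  rw [target_eq_iff (by norm_num), isAntecedent_five_iff] at hn
  exact height_le ((show ∀ s ∈ verticesFive, f^[4] s ≤ 9 by decide +kernel) _ hn)

theorem exists_target_eq_height_eq_one {d : ℕ} (hd : d ∈ ({1, 3, 7, 9} : Set ℕ)) :
    ∃ n, target n = d ∧ height n = 1 := by
  have hf : f (10 + d) = d := by
    simp only [Set.mem_insert_iff, Set.mem_singleton_iff] at hd
    rcases hd with rfl | rfl | rfl | rfl <;> decide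
  have hd' := le_nine_of_mem hd
  have hpos : 9 < 10 + d := by omega
  refine ⟨10 + d, ?_, ?_⟩
  · rw [← target_f, hf, target_of_le_nine hd']
  · rw [height_eq_succ hpos, hf, height_eq_zero hd']

theorem exists_target_eq_five_height_eq_five : ∃ n, target n = 5 ∧ height n = 5 := by
  -- The digit product of `995377` is the vertex `59535` farthest from the root of the tree.
  have h₁ : f 995377 = 59535 := by decide +kernel
  have h₂ : f 59535 = 3375 := by decide +kernel
  have h₃ : f 3375 = 315 := by decide
  have h₄ : f 315 = 15 := by decide
  have h₅ : f 15 = 5 := by decide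
  refine ⟨995377, ?_, ?_⟩
  · rw [← target_f, h₁, ← target_f, h₂, ← target_f, h₃, ← target_f, h₄, ← target_f, h₅,
      target_of_le_nine (by norm_num)]
  · rw [height_eq_succ (by norm_num), h₁, height_eq_succ (by norm_num), h₂,
      height_eq_succ (by norm_num), h₃, height_eq_succ (by norm_num), h₄,
      height_eq_succ (by norm_num), h₅, height_eq_zero (by norm_num)]

end MultPersistence

theorem mainTheorem1 :
    -- the trees of antecedents of the odd digits are the explicit graphs
    (∀ d ∈ ({1, 3, 5, 7, 9} : Set ℕ), antecedentTree d = explicitGraph d) ∧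
    -- the numbers with a given odd target
    (∀ d ∈ ({1, 3, 5, 7, 9} : Set ℕ),
      {n | target n = d} =
        ⋃ (α : ℕ) (β : ℕ) (γ : ℕ) (_ : 3 ^ α * 5 ^ β * 7 ^ γ ∈ (explicitGraph d).verts),
          ⋃ (α₁ : ℕ) (α₂ : ℕ) (_ : α₁ + 2 * α₂ = α), digitClass α₁ β γ α₂) ∧
    -- the optimal bounds
    (∀ d ∈ ({1, 3, 7, 9} : Set ℕ),
      (∀ n, target n = d → height n ≤ 1) ∧ ∃ n, target n = d ∧ height n = 1) ∧
    ((∀ n, target n = 5 → height n ≤ 5) ∧ ∃ n, target n = 5 ∧ height n = 5) ∧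
    -- all odd targets together
    (∀ n, Odd (target n) → height n ≤ 5) := by
  refine ⟨fun d hd => antecedentTree_eq_explicitGraph hd, fun d hd => setOf_target_eq hd,
    fun d hd => ⟨fun n hn => height_le_one hd hn, exists_target_eq_height_eq_one hd⟩,
    ⟨fun n hn => height_le_five hn, exists_target_eq_five_height_eq_five⟩, fun n hn => ?_⟩
  by_cases h5 : target n = 5
  · exact height_le_five h5
  · refine (height_le_one (d := target n) ?_ rfl).trans (by norm_num)
    have := target_le_nine n
    rw [Nat.odd_iff] at hn
    simp only [Set.mem_insert_iff, Set.mem_singleton_iff]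
    omega
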